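/- **Properties of the Ehrenfest process.** Let $N\in\mathbb N$, $\lambda>0$, $\alpha,\beta\in(0,1]$, and put $p:=\frac{\alpha}{\alpha+\beta}$, $q:=1-p$. Let $(\hat Y^l_n)_{n\ge 0}$, $l=1,\dots,N$, be Markov chains on $\{0,1\}$ with transition matrix $\begin{pmatrix}1-\alpha&\alpha\\ \beta&1-\beta\end{pmatrix}$ which move independently of each other from an arbitrary initial configuration, i.e. $(\hat Y^1_n,\dots,\hat Y^N_n)_{n\ge 0}$ is a Markov chain on $\{0,1\}^N$, with arbitrary initial distribution, whose transition matrix is the product of the one-coordinate matrices (in particular, the chains may be mutually independent). Let $(N^1_t)_{t\ge0},\dots,(N^N_t)_{t\ge 0}$ be independent Poisson processes with intensity $\lambda$, independent of the chains. The (continuous time) Ehrenfest process is $X_t:=\sum_{l=1}^N Y^l_t$ with $Y^l_t:=\hat Y^l_{N^l_t}$, $t\ge 0$; its state space is $E=\{0,\dots,N\}$. For $l,x\in E$ let $$K_l(x):=\sum_{k=0}^N\frac{(-l)_k(-x)_k}{(-N)_k\,k!}\Bigl(\frac1p\Bigr)^k$$ be the Krawtchouk polynomials, where $(a)_k=a(a+1)\cdots(a+k-1)$.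 Then the following hold. (a) For every $s>0$ and $i\in E$ one has $\mathbb P(X_s=i)>0$. For all $s,t\ge 0$ and $i,j\in E$ with $\mathbb P(X_s=i)>0$, the transition probability $p_{ij}(t):=\mathbb P(X_{t+s}=j\mid X_s=i)$ is given by $$p_{ij}(t)=\binom Nj\Bigl(\frac pq\Bigr)^j\sum_{x=0}^N\binom Nx p^xq^{N-x}K_i(x)K_j(x)e^{-\lambda(\alpha+\beta)xt};$$ in particular it does not depend on $s$. (b) For all $t\ge0$ and $i\in E$ with $\mathbb P(X_0=i)>0$, $$\mathbb E[X_t\mid X_0=i]=Np-(Np-i)e^{-\lambda(\alpha+\beta)t},$$ $$\mathrm{Var}[X_t\mid X_0=i]=Np(1-p)+(Np-i)(2p-1)e^{-\lambda(\alpha+\beta)t}-\bigl(Np(1-p)+(Np-i)(2p-1)\bigr)e^{-2\lambda(\alpha+\beta)t}.$$ (c) The stationary distribution is the limiting distribution, and it is the binomial distribution $B_{N,p}$. Precisely: a probability distribution $\pi$ on $E$ satisfies $\sum_{i\in E}\pi_i\,p_{ij}(t)=\pi_j$ for all $t\ge0$ and $j\in E$ if and only if $\pi=B_{N,p}$; the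 law of $X_t$ equals the law of $X_0$ for all $t\ge0$ if and only if $X_0\sim B_{N,p}$; and, for all $j\in E$, as $t\to\infty$, $\mathbb P(X_{t+s}=j\mid X_s=i)\to B_{N,p}(\{j\})$ for all $s\ge 0$ and $i\in E$ with $\mathbb P(X_s=i)>0$, and $\mathbb P(X_t=j)\to B_{N,p}(\{j\})$ for every initial distribution. -/

import Mathlib

open MeasureTheory ProbabilityTheory Filter Topology
open scoped NNReal ENNReal

namespace Ehrenfest

noncomputable section

variable {Ω : Type*} [MeasurableSpace Ω]

/-- The Krawtchouk polynomial `K_l(x) = K_l(x; N; p) = ₂F₁(-l, -x; -N; 1/p)`, i.e.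
`∑_{k=0}^N (-l)_k (-x)_k / ((-N)_k k!) (1/p)^k` with rising Pochhammer symbols `(a)_k`,
for `0 ≤ l, x ≤ N`. -/
def krawtchouk (N : ℕ) (p : ℝ) (l x : ℕ) : ℝ :=
  ∑ k ∈ Finset.range (N + 1),
    ((ascPochhammer ℝ k).eval (-(l : ℝ)) * (ascPochhammer ℝ k).eval (-(x : ℝ))) /
      ((ascPochhammer ℝ k).eval (-(N : ℝ)) * (k.factorial : ℝ)) * (1 / p) ^ k

/-- `T` is a Poisson process with intensity `lam` under `μ`. -/
structure IsPoissonProcess (T : ℝ≥0 → Ω → ℕ) (lam : ℝ≥0) (μ : Measure Ω) : Prop where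
  measurable : ∀ t, Measurable (T t)
  zero : ∀ᵐ ω ∂μ, T 0 ω = 0
  paths : ∀ᵐ ω ∂μ, Monotone (fun t => T t ω) ∧
    ∀ t, ContinuousWithinAt (fun s => T s ω) (Set.Ici t) t
  indep : HasIndepIncrements T μ
  law : ∀ s h : ℝ≥0, HasLaw (fun ω => T (s + h) ω - T s ω) (poissonMeasure (lam * h)) μ

/-- `Z` is a time-homogeneous discrete-time Markov chain with transition probability matrix `Q`
and arbitrary initial distribution. -/
structure IsMarkovChain {S : Type*} [MeasurableSpace S] (Z : ℕ → Ω → S) (Q : Matrix S S ℝ)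
    (μ : Measure Ω) : Prop where
  measurable : ∀ n, Measurable (Z n)
  path_prob : ∀ (n : ℕ) (z : ℕ → S),
    μ.real {ω | ∀ k ≤ n, Z k ω = z k} =
      μ.real {ω | Z 0 ω = z 0} * ∏ k ∈ Finset.range n, Q (z k) (z (k + 1))

/-- The transition probability matrix of a single ball (`1`: urn I, `0`: urn II). -/
def ballMatrix (α β : ℝ) : Matrix (Fin 2) (Fin 2) ℝ :=
  !![1 - α, α; β, 1 - β]

/-- Independent moves of `N` balls: the transition matrix on configurations `Fin N → Fin 2` is the
product of the one-ball transition matrices. -/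
def configMatrix (N : ℕ) (α β : ℝ) : Matrix (Fin N → Fin 2) (Fin N → Fin 2) ℝ :=
  Matrix.of fun y z => ∏ l, ballMatrix α β (y l) (z l)

/-- The data of the Ehrenfest model: two-state chains `Yhat l` (`l`-th ball) with transition matrix
`ballMatrix α β` that move independently of each other from an arbitrarily distributed initial
configuration, and Poisson clocks `T l` with intensity `lam`, independent of each other and of
the chains. -/
structure IsEhrenfestSystem (N : ℕ) (lam : ℝ≥0) (α β : ℝ) (Yhat : Fin N → ℕ → Ω → Fin 2)
    (T : Fin N → ℝ≥0 → Ω → ℕ) (μ : Measure Ω) : Prop where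
  chains : IsMarkovChain (fun n ω l => Yhat l n ω) (configMatrix N α β) μ
  poisson : ∀ l, IsPoissonProcess (T l) lam μ
  poisson_indep : iIndepFun (fun l ω t => T l t ω) μ
  chains_indep_poisson : IndepFun (fun ω l n => Yhat l n ω) (fun ω l t => T l t ω) μ

/-- The subordinated chain `Y^l_t = Yhat^l_{T^l_t}`: the state of the `l`-th ball at time `t`. -/
def ball {N : ℕ} (Yhat : Fin N → ℕ → Ω → Fin 2) (T : Fin N → ℝ≥0 → Ω → ℕ) (l : Fin N)
    (t : ℝ≥0) (ω : Ω) : Fin 2 :=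
  Yhat l (T l t ω) ω

/-- The Ehrenfest process `X_t = ∑_l Y^l_t`: the number of balls in urn I at time `t`. -/
def process {N : ℕ} (Yhat : Fin N → ℕ → Ω → Fin 2) (T : Fin N → ℝ≥0 → Ω → ℕ)
    (t : ℝ≥0) (ω : Ω) : ℕ :=
  ∑ l, (ball Yhat T l t ω : ℕ)

/-- The conditional probability `P(X_{t+s} = j | X_s = i)`. -/
def transProb (X : ℝ≥0 → Ω → ℕ) (μ : Measure Ω) (s t : ℝ≥0) (i j : ℕ) : ℝ :=
  (cond μ {ω | X s ω = i}).real {ω | X (t + s) ω = j}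

/-- Mutually independent two-state Markov chains are a special case of balls moving independently
from an arbitrary initial configuration. -/
theorem isMarkovChain_of_iIndepFun {N : ℕ} {α β : ℝ} {Yhat : Fin N → ℕ → Ω → Fin 2}
    {μ : Measure Ω} (h : ∀ l, IsMarkovChain (Yhat l) (ballMatrix α β) μ)
    (hind : iIndepFun (fun l ω n => Yhat l n ω) μ) :
    IsMarkovChain (fun n ω l => Yhat l n ω) (configMatrix N α β) μ := by
  refine ⟨fun n => measurable_pi_lambda _ fun l => (h l).measurable n, fun n z => ?_⟩
  have key : ∀ m : ℕ, μ.real {ω | ∀ k ≤ m, (fun l => Yhat l k ω) = z k} =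
      ∏ l, μ.real {ω | ∀ k ≤ m, Yhat l k ω = z k l} := by
    intro m
    have hm : ∀ l : Fin N, MeasurableSet {y : ℕ → Fin 2 | ∀ k ≤ m, y k = z k l} := by
      intro l
      simp only [Set.ofPred_forall]
      exact MeasurableSet.iInter fun k => MeasurableSet.iInter fun _ =>
        measurableSet_eq_fun (measurable_pi_apply k) measurable_const
    have e := hind.measure_inter_preimage_eq_mul Finset.univ
      (sets := fun l => {y : ℕ → Fin 2 | ∀ k ≤ m, y k = z k l}) (fun l _ => hm l)
    have e2 : {ω | ∀ k ≤ m, (fun l => Yhat l k ω) = z k} =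
        ⋂ l ∈ (Finset.univ : Finset (Fin N)), (fun ω n => Yhat l n ω) ⁻¹'
          {y : ℕ → Fin 2 | ∀ k ≤ m, y k = z k l} := by
      ext ω
      simp only [Set.mem_ofPred_eq, funext_iff, Set.mem_iInter, Set.mem_preimage]
      exact ⟨fun H l _ k hk => H k hk l, fun H k hk l => H l (Finset.mem_univ _) k hk⟩
    rw [measureReal_def, e2, e, ENNReal.toReal_prod]
    rfl
  have k0 := key 0
  simp only [Nat.le_zero, forall_eq] at k0
  rw [key n, k0, Finset.prod_congr rfl fun l _ => (h l).path_prob n fun k => z k l,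
    Finset.prod_mul_distrib, Finset.prod_comm]
  rfl

end

end Ehrenfest

/-! The argument diagonalises a single ball. The one-ball matrix has eigenvalues 1 and r = 1 - (α +
β), so its powers interpolate linearly, with parameter r ^ n, between the identity and the rank-one
stationary matrix (`ballMatrix_pow`). Averaging r ^ n over a Poisson clock replaces it by e =
exp(-λ(α + β)t). Since the clocks are independent of each other and of the chains, two-time
probabilities of configurations are products over the balls (`IsEhrenfestSystem.measureReal_ball`).
The balls are read at different random times, so this needs path probabilities of the product chain
with a separate time for each coordinate (`IsMarkovChain.measureReal_two_times`).

Given i balls in urn I, the count at time t later has generating function `genPoly`: a product of i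
copies of one linear factor and N - i of another. It depends on the configuration only through its
count (`sum_prod_ballProb`), so the count inherits the transition law
(`IsEhrenfestSystem.measureReal_process_inter`).

All claims are then properties of `genPoly`. Two uses of the Krawtchouk generating function give its
coefficients (`coeff_genPoly`), derivatives at 1 give the moments, e → 0 gives the binomial limit,
and mixing over binomial i gives invariance. Uniqueness of the invariant law follows from the limit.
-/

namespace Ehrenfest

open Polynomial

/-! ### Krawtchouk polynomials and the generating function of the ball count. -/

/-- Krawtchouk polynomials in terms of binomial coefficients. -/
theorem krawtchouk_eq_sum_choose (N : ℕ) (p : ℝ) (l x : ℕ) :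
    krawtchouk N p l x = ∑ k ∈ Finset.range (N + 1),
      ((l.choose k : ℝ) * x.choose k) / N.choose k * (-(1 / p)) ^ k := by
  have key : ∀ a k : ℕ, (ascPochhammer ℝ k).eval (-(a : ℝ)) =
      (-1) ^ k * (k.factorial * a.choose k) := by
    intro a k
    rw [ascPochhammer_eval_neg_eq_descPochhammer, descPochhammer_eval_eq_descFactorial,
      Nat.descFactorial_eq_factorial_mul_choose]
    push_cast
    ring
  refine Finset.sum_congr rfl fun k hk => ?_
  have hk' : k ≤ N := Nat.lt_succ_iff.mp (Finset.mem_range.mp hk)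
  have h1 : (N.choose k : ℝ) ≠ 0 := by exact_mod_cast (Nat.choose_pos hk').ne'
  have h2 : (k.factorial : ℝ) ≠ 0 := by exact_mod_cast k.factorial_ne_zero
  have h3 : ((-1 : ℝ) ^ k) ≠ 0 := pow_ne_zero _ (by norm_num)
  rw [key, key, key, neg_pow (1 / p)]
  have h4 : ((-1 : ℝ) ^ k) * (-1) ^ k = 1 := by rw [← mul_pow]; norm_num
  field_simp

theorem krawtchouk_comm (N : ℕ) (p : ℝ) (l x : ℕ) : krawtchouk N p l x = krawtchouk N p x l := by
  simp only [krawtchouk, mul_comm]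

theorem choose_mul_choose_div {N x k : ℕ} (hk : k ≤ x) (hx : x ≤ N) :
    (N.choose x : ℝ) * x.choose k / N.choose k = (N - k).choose (x - k) := by
  have h1 : (N.choose k : ℝ) ≠ 0 := by exact_mod_cast (Nat.choose_pos (hk.trans hx)).ne'
  rw [div_eq_iff h1]
  rw [mul_comm ((N - k).choose (x - k) : ℝ)]
  exact_mod_cast Nat.choose_mul hk

/-- The homogeneous generating function of the Krawtchouk polynomials. -/
theorem sum_choose_mul_krawtchouk {A : Type*} [CommRing A] [Algebra ℝ A] {N i : ℕ} (p : ℝ)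
    (hi : i ≤ N) (a b : A) :
    ∑ x ∈ Finset.range (N + 1),
        algebraMap ℝ A (N.choose x * krawtchouk N p i x) * a ^ x * b ^ (N - x) =
      (a + b) ^ (N - i) * (a + b - algebraMap ℝ A (1 / p) * a) ^ i := by
  have e1 : ∀ x ∈ Finset.range (N + 1),
      algebraMap ℝ A (N.choose x * krawtchouk N p i x) * a ^ x * b ^ (N - x) =
      ∑ k ∈ Finset.range (N + 1), algebraMap ℝ A (i.choose k * (-(1 / p)) ^ k) *
        (algebraMap ℝ A (N.choose x * x.choose k / N.choose k) * a ^ x * b ^ (N - x)) := by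
    intro x hx
    rw [krawtchouk_eq_sum_choose,
      Finset.mul_sum, map_sum, Finset.sum_mul, Finset.sum_mul]
    refine Finset.sum_congr rfl fun k _ => ?_
    rw [← mul_assoc (algebraMap ℝ A _) (_ * _), ← mul_assoc (algebraMap ℝ A _), ← map_mul]
    congr 3
    ring
  -- Terms with x < k vanish; after absorbing the binomial coefficients the rest is a binomial
  -- expansion of exponent N - k.
  have e2 : ∀ k ∈ Finset.range (N + 1), ∑ x ∈ Finset.range (N + 1),
      algebraMap ℝ A (N.choose x * x.choose k / N.choose k) * a ^ x * b ^ (N - x) =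
        a ^ k * (a + b) ^ (N - k) := by
    intro k hk
    have hk' : k ≤ N := Nat.lt_succ_iff.mp (Finset.mem_range.mp hk)
    have hN : N + 1 = k + (N - k + 1) := by omega
    rw [hN, Finset.sum_range_add, Finset.sum_eq_zero, zero_add, add_pow, Finset.mul_sum]
    · refine Finset.sum_congr rfl fun m hm => ?_
      have hm' : m ≤ N - k := Nat.lt_succ_iff.mp (Finset.mem_range.mp hm)
      rw [choose_mul_choose_div (Nat.le_add_right k m) (by omega), Nat.add_sub_cancel_left,
        pow_add, show N - (k + m) = N - k - m by omega]
      simp only [map_natCast]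
      ring
    · intro x hx
      simp [Nat.choose_eq_zero_of_lt (Finset.mem_range.mp hx)]
  rw [Finset.sum_congr rfl e1, Finset.sum_comm]
  simp_rw [← Finset.mul_sum]
  rw [Finset.sum_congr rfl fun k hk => by rw [e2 k hk]]
  -- Only k ≤ i contributes, and what remains is the expansion of (a + b - a/p) ^ i.
  rw [show N + 1 = (i + 1) + (N - i) by omega, Finset.sum_range_add]
  rw [Finset.sum_eq_zero (s := Finset.range (N - i)), add_zero, sub_eq_neg_add, add_pow _ _ i,
    Finset.mul_sum]
  · refine Finset.sum_congr rfl fun k hk => ?_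
    have hk' : k ≤ i := Nat.lt_succ_iff.mp (Finset.mem_range.mp hk)
    rw [show N - k = (N - i) + (i - k) by omega, pow_add, ← neg_mul, mul_pow, ← map_neg, map_mul,
      map_pow, map_natCast]
    ring
  · intro k _
    rw [Nat.choose_eq_zero_of_lt (by omega)]
    simp

/-- The probability generating function of the number of balls in urn I when `i` of the `N` balls
start in urn I and the correlation with the initial state has decayed to `e`. -/
noncomputable def genPoly (N : ℕ) (p e : ℝ) (i : ℕ) : ℝ[X] :=
  (C ((1 - p) * (1 - e)) + C (p + (1 - p) * e) * X) ^ i *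
    (C (1 - p + p * e) + C (p * (1 - e)) * X) ^ (N - i)

/-- The generating function is used twice: with a = pe(1 - X), b = (1 - p) + pX it expands `genPoly`
in powers of e; with a = pX/(1 - p), b = 1 it expands each resulting term in powers of X. Symmetry
of K in its two arguments then gives the stated form. -/
theorem coeff_genPoly {N i j : ℕ} {p : ℝ} (hp0 : 0 < p) (hp1 : p < 1) (e : ℝ) (hi : i ≤ N)
    (hj : j ≤ N) :
    (genPoly N p e i).coeff j = (N.choose j : ℝ) * (p / (1 - p)) ^ j *
      ∑ x ∈ Finset.range (N + 1), (N.choose x : ℝ) * p ^ x * (1 - p) ^ (N - x) *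
        krawtchouk N p i x * krawtchouk N p j x * e ^ x := by
  have hp : p ≠ 0 := hp0.ne'
  have hq : 1 - p ≠ 0 := by linarith
  have h1 : genPoly N p e i = ∑ x ∈ Finset.range (N + 1),
      C ((N.choose x : ℝ) * krawtchouk N p i x) * (C (p * e) * (1 - X)) ^ x *
        (C (1 - p) + C p * X) ^ (N - x) := by
    rw [← Polynomial.algebraMap_eq, sum_choose_mul_krawtchouk p hi, Polynomial.algebraMap_eq,
      genPoly, mul_comm]
    have h : C (1 / p) * C p = (1 : ℝ[X]) := by rw [← C_mul]; simp [hp]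
    congr 2
    · simp only [C_add, C_sub, C_mul, C_1]; ring
    · simp only [C_add, C_sub, C_mul, C_1]; linear_combination (C e * (1 - X)) * h
  have h2 : ∀ x ≤ N, ((1 - X : ℝ[X]) ^ x * (C (1 - p) + C p * X) ^ (N - x)).coeff j =
      (1 - p) ^ (N - x) * ((N.choose j : ℝ) * (p / (1 - p)) ^ j * krawtchouk N p x j) := by
    intro x hx
    have h := sum_choose_mul_krawtchouk (A := ℝ[X]) p hx (C (p / (1 - p)) * X) 1
    have ha : (1 - X : ℝ[X]) =
        C (p / (1 - p)) * X + 1 - algebraMap ℝ ℝ[X] (1 / p) * (C (p / (1 - p)) * X) := by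
      rw [Polynomial.algebraMap_eq, ← mul_assoc, ← C_mul]
      have : C (1 / p * (p / (1 - p))) = (C (p / (1 - p)) + 1 : ℝ[X]) := by
        rw [← C_1, ← C_add]; congr 1; field_simp; ring
      rw [this]; ring
    have hb : C (1 - p) + C p * X = C (1 - p) * (C (p / (1 - p)) * X + 1 : ℝ[X]) := by
      rw [mul_add, ← mul_assoc, ← C_mul, mul_div_cancel₀ _ hq]; ring
    rw [ha, hb, mul_pow, ← C_pow, mul_left_comm, coeff_C_mul, mul_comm (_ ^ x), ← h]
    congr 1
    simp only [one_pow, mul_one, Polynomial.algebraMap_eq, mul_pow, ← C_pow, ← mul_assoc, ← C_mul,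
      finsetSum_coeff, coeff_C_mul, coeff_X_pow, mul_ite, mul_zero]
    rw [Finset.sum_ite_eq (Finset.range (N + 1)), if_pos (Finset.mem_range.mpr (by omega))]
    ring
  rw [h1, finsetSum_coeff, Finset.mul_sum]
  refine Finset.sum_congr rfl fun x hx => ?_
  rw [mul_pow, mul_assoc, mul_assoc, ← C_pow, coeff_C_mul, coeff_C_mul,
    h2 x (Nat.lt_succ_iff.mp (Finset.mem_range.mp hx)), krawtchouk_comm N p x j, mul_pow]
  ring

/-- At e = 0 both linear factors become (1 - p) + pX, so the initial count i is forgotten. -/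
theorem coeff_genPoly_zero {N i j : ℕ} {p : ℝ} (hi : i ≤ N) :
    (genPoly N p 0 i).coeff j = (N.choose j : ℝ) * p ^ j * (1 - p) ^ (N - j) := by
  have : genPoly N p 0 i = (C p * X + C (1 - p)) ^ N := by
    rw [genPoly, ← Nat.add_sub_of_le hi, pow_add, Nat.add_sub_cancel_left]
    simp [add_comm]
  rw [this, add_pow, finsetSum_coeff]
  have h : ∀ m, (C p * X) ^ m * C (1 - p) ^ (N - m) * (N.choose m : ℝ[X]) =
      C (p ^ m * (1 - p) ^ (N - m) * N.choose m) * X ^ m := by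
    intro m
    simp only [C_mul, C_pow, C_eq_natCast]
    ring
  simp_rw [h, coeff_C_mul, coeff_X_pow, mul_ite, mul_zero]
  rw [Finset.sum_ite_eq (Finset.range (N + 1))]
  split_ifs with h
  · ring
  · rw [Nat.choose_eq_zero_of_lt (by simpa using h)]; simp

theorem natDegree_genPoly_le {N i : ℕ} (p e : ℝ) (hi : i ≤ N) :
    (genPoly N p e i).natDegree ≤ N := by
  have h : ∀ a b : ℝ, (C a + C b * X).natDegree ≤ 1 := fun a b => by
    rw [add_comm]; exact natDegree_linear_le
  refine natDegree_mul_le.trans ?_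
  refine (add_le_add (natDegree_pow_le_of_le i (h _ _))
    (natDegree_pow_le_of_le (N - i) (h _ _))).trans ?_
  omega

/-- First factorial moment. -/
theorem eval_one_derivative_genPoly {N i : ℕ} (p e : ℝ) (hi : i ≤ N) :
    (derivative (genPoly N p e i)).eval 1 = i * (p + (1 - p) * e) + (N - i) * (p * (1 - e)) := by
  have h1 : (1 - p) * (1 - e) + (p + (1 - p) * e) = 1 := by ring
  have h2 : 1 - p + p * e + p * (1 - e) = 1 := by ring
  simp only [genPoly, derivative_mul, derivative_pow, derivative_add, derivative_C, derivative_X,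
    eval_mul, eval_pow, eval_add, eval_C, eval_X, mul_one, h1, h2, one_pow, zero_mul,
    zero_add, one_mul]
  push_cast [hi]
  ring

/-- Second factorial moment. -/
theorem eval_one_derivative_derivative_genPoly {N i : ℕ} (p e : ℝ) (hi : i ≤ N) :
    (derivative (derivative (genPoly N p e i))).eval 1 =
      i * (i - 1) * (p + (1 - p) * e) ^ 2 +
        2 * i * (N - i) * (p + (1 - p) * e) * (p * (1 - e)) +
        (N - i) * (N - i - 1) * (p * (1 - e)) ^ 2 := by
  have h1 : (1 - p) * (1 - e) + (p + (1 - p) * e) = 1 := by ring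
  have h2 : 1 - p + p * e + p * (1 - e) = 1 := by ring
  -- Truncated subtraction at n = 0 is harmless because of the factor n.
  have h3 : ∀ n : ℕ, (n : ℝ) * ((n - 1 : ℕ) : ℝ) = n * (n - 1) := by
    rintro (_ | n) <;> simp
  have h4 : ((N - i : ℕ) : ℝ) = N - i := by push_cast [hi]; ring
  simp only [genPoly, derivative_mul, derivative_pow, derivative_add, derivative_C, derivative_X,
    eval_mul, eval_pow, eval_add, eval_C, eval_X, mul_one, h1, h2, one_pow, zero_mul,
    zero_add, one_mul, mul_zero, add_zero]
  have hi3 := h3 i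
  have hn3 := h3 (N - i)
  rw [h4] at hn3 ⊢
  linear_combination (p + (1 - p) * e) ^ 2 * hi3 + (p * (1 - e)) ^ 2 * hn3

/-- The binomial weights are invariant. -/
theorem sum_binomial_mul_genPoly (N : ℕ) (p e : ℝ) :
    ∑ i ∈ Finset.range (N + 1),
        C ((N.choose i : ℝ) * p ^ i * (1 - p) ^ (N - i)) * genPoly N p e i =
      genPoly N p 0 0 := by
  -- Mixing the two linear factors with weights p and 1 - p cancels e: this is stationarity of one
  -- ball.
  have : genPoly N p 0 0 = (C p * (C ((1 - p) * (1 - e)) + C (p + (1 - p) * e) * X) +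
      C (1 - p) * (C (1 - p + p * e) + C (p * (1 - e)) * X)) ^ N := by
    rw [genPoly, pow_zero, one_mul, Nat.sub_zero]
    congr 1
    simp only [C_add, C_sub, C_mul, C_1, C_0]
    ring
  rw [this, add_pow]
  refine Finset.sum_congr rfl fun i _ => ?_
  simp only [genPoly, mul_pow, C_mul, C_pow, ← C_eq_natCast]
  ring

/-! ### One ball, and the passage from configurations to counts. -/

/-- Two-time marginals of one ball. -/
noncomputable def ballProb (p e : ℝ) (a b : Fin 2) : ℝ :=
  ![1 - p, p] b + e * ((if a = b then 1 else 0) - ![1 - p, p] b)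

theorem ballProb_pos {p e : ℝ} (hp0 : 0 < p) (hp1 : p < 1) (he0 : 0 ≤ e) (he1 : e < 1)
    (a b : Fin 2) : 0 < ballProb p e a b := by
  have h1 : 0 < (1 - p) * (1 - e) := mul_pos (by linarith) (by linarith)
  have h2 : 0 < p * (1 - e) := mul_pos (by linarith) (by linarith)
  fin_cases a <;> fin_cases b <;> simp [ballProb] <;> linarith

/-- Spectral form of the powers: the stationary part is fixed, and its complement is multiplied by
the second eigenvalue 1 - (α + β) at each step. -/
theorem ballMatrix_pow {α β : ℝ} (h : α + β ≠ 0) (n : ℕ) (a b : Fin 2) :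
    (ballMatrix α β ^ n) a b = ballProb (α / (α + β)) ((1 - (α + β)) ^ n) a b := by
  induction n generalizing b with
  | zero => fin_cases a <;> fin_cases b <;> simp [ballProb]
  | succ n ih =>
    rw [pow_succ, Matrix.mul_apply, Fin.sum_univ_two, ih, ih, pow_succ]
    generalize (1 - (α + β)) ^ n = r
    fin_cases a <;> fin_cases b <;> simp [ballProb, ballMatrix] <;> field_simp <;> ring

theorem sum_ballMatrix (α β : ℝ) (a : Fin 2) : ∑ b, ballMatrix α β a b = 1 := by
  fin_cases a <;> simp [ballMatrix]

/-- The number of balls in urn I in a given configuration. -/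
def count {N : ℕ} (y : Fin N → Fin 2) : ℕ := ∑ l, (y l : ℕ)

theorem count_le {N : ℕ} (y : Fin N → Fin 2) : count y ≤ N := by
  refine (Finset.sum_le_card_nsmul Finset.univ _ 1 fun l _ => by omega).trans ?_
  simp

theorem exists_count_eq {N i : ℕ} (hi : i ≤ N) : ∃ y : Fin N → Fin 2, count y = i := by
  refine ⟨fun l => if (l : ℕ) < i then 1 else 0, ?_⟩
  have : ∀ l : Fin N, (((if (l : ℕ) < i then 1 else 0 : Fin 2)) : ℕ) =
      if (l : ℕ) < i then 1 else 0 := by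
    intro l; split_ifs <;> rfl
  simp only [count, this]
  rw [Fin.sum_univ_eq_sum_range (fun l => if l < i then 1 else 0) N, ← Finset.sum_filter,
    Finset.sum_const, smul_eq_mul, mul_one]
  have : (Finset.range N).filter (· < i) = Finset.range i := by
    ext k; simp; omega
  rw [this, Finset.card_range]

/-- The transition probabilities of the ball count only depend on the count of the initial
configuration. -/
theorem sum_prod_ballProb {N : ℕ} (p e : ℝ) (y : Fin N → Fin 2) (j : ℕ) :
    ∑ z : Fin N → Fin 2, (if count z = j then ∏ l, ballProb p e (y l) (z l) else 0) =
      (genPoly N p e (count y)).coeff j := by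
  -- The generating function of a sum of independent indicators is a product; each ball contributes
  -- one of two factors according to its starting urn.
  have h1 : ∏ l, ∑ b : Fin 2, C (ballProb p e (y l) b) * X ^ (b : ℕ) = genPoly N p e (count y) := by
    have : ∀ l, ∑ b : Fin 2, C (ballProb p e (y l) b) * X ^ (b : ℕ) =
        (C ((1 - p) * (1 - e)) + C (p + (1 - p) * e) * X) ^ (y l : ℕ) *
          (C (1 - p + p * e) + C (p * (1 - e)) * X) ^ (1 - (y l : ℕ)) := by
      intro l
      generalize y l = a
      fin_cases a <;> simp [ballProb, Fin.sum_univ_two] <;> ring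
    rw [Finset.prod_congr rfl fun l _ => this l, Finset.prod_mul_distrib,
      Finset.prod_pow_eq_pow_sum, Finset.prod_pow_eq_pow_sum, genPoly]
    congr 2
    have h : count y + ∑ l, (1 - (y l : ℕ)) = N := by
      rw [count, ← Finset.sum_add_distrib, Finset.sum_congr rfl (g := fun _ => 1)]
      · simp
      · intro l _; omega
    omega
  rw [← h1, Finset.prod_univ_sum, Fintype.piFinset_univ, finsetSum_coeff]
  refine Finset.sum_congr rfl fun z _ => ?_
  rw [Finset.prod_mul_distrib, Finset.prod_pow_eq_pow_sum, ← map_prod, coeff_C_mul, coeff_X_pow]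
  change _ = _ * if j = count z then _ else _
  simp only [eq_comm, mul_ite, mul_one, mul_zero]

end Ehrenfest

/-! ### Path probabilities of a product chain observed at coordinate-dependent times. -/

namespace Ehrenfest

open Classical in
/-- The probability that a chain with transition matrix `Q` started at `w` satisfies the
constraints `C` up to time `n`. -/
noncomputable def pathWeight {S : Type*} [Fintype S] (Q : Matrix S S ℝ) :
    ℕ → (ℕ → S → Prop) → S → ℝ
  | 0, C, w => if C 0 w then 1 else 0
  | n + 1, C, w => if C 0 w then ∑ u, Q w u * pathWeight Q n (fun k => C (k + 1)) u else 0

theorem pathWeight_true {S : Type*} [Fintype S] {Q : Matrix S S ℝ}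
    (hQ : ∀ a, ∑ b, Q a b = 1) (n : ℕ) (w : S) :
    pathWeight Q n (fun _ _ => True) w = 1 := by
  induction n generalizing w with
  | zero => simp [pathWeight]
  | succ n ih => simp [pathWeight, ih, hQ]

/-- The unconstrained steps after time m sum out because the rows of Q sum to 1. -/
theorem pathWeight_eq_pow {S : Type*} [Fintype S] [DecidableEq S] {Q : Matrix S S ℝ}
    (hQ : ∀ a, ∑ b, Q a b = 1) {m n : ℕ} (hm : m ≤ n) (w z : S) :
    pathWeight Q n (fun k u => k = m → u = z) w = (Q ^ m) w z := by
  induction n generalizing m w with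
  | zero =>
    obtain rfl : m = 0 := by omega
    simp [pathWeight, Matrix.one_apply]
  | succ n ih =>
    cases m with
    | zero =>
      simp [pathWeight, Matrix.one_apply, pathWeight_true hQ, hQ]
    | succ m =>
      simp only [pathWeight, Nat.add_right_cancel_iff]
      rw [if_pos (by simp), pow_succ', Matrix.mul_apply]
      exact Finset.sum_congr rfl fun u _ => by rw [ih (by omega)]

/-- While m > 0 the first step is free and peels off one factor Q; at m = 0 the start is pinned to y
and a single constraint at time d remains. -/
theorem pathWeight_eq_pow_mul_pow {S : Type*} [Fintype S] [DecidableEq S] {Q : Matrix S S ℝ}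
    (hQ : ∀ a, ∑ b, Q a b = 1) {m d n : ℕ} (hm : m + d ≤ n) (w y z : S) :
    pathWeight Q n (fun k u => (k = m → u = y) ∧ (k = m + d → u = z)) w =
      (Q ^ m) w y * (Q ^ d) y z := by
  induction n generalizing m w with
  | zero =>
    obtain ⟨rfl, rfl⟩ : m = 0 ∧ d = 0 := by omega
    by_cases h1 : w = y <;> by_cases h2 : w = z <;>
      simp_all [pathWeight, Matrix.one_apply]
  | succ n ih =>
    cases m with
    | zero =>
      have key := pathWeight_eq_pow hQ (show d ≤ n + 1 by omega) w z
      rw [pathWeight] at key ⊢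
      simp only [forall_const, zero_add, Nat.add_eq_zero_iff, one_ne_zero, and_false,
        IsEmpty.forall_iff, true_and, pow_zero, Matrix.one_apply] at key ⊢
      by_cases h1 : w = y
      · subst h1
        simp only [true_and, if_true, one_mul]
        convert key
      · simp [h1]
    | succ m =>
      simp only [pathWeight, Nat.add_right_cancel_iff, show m + 1 + d = (m + d) + 1 by omega]
      rw [if_pos (by simp), pow_succ', Matrix.mul_apply, Finset.sum_mul]
      exact Finset.sum_congr rfl fun u _ => by rw [ih (by omega), mul_assoc]

section Chain

variable {Ω S : Type*} [MeasurableSpace Ω] [MeasurableSpace S] {μ : Measure Ω}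

theorem measureReal_eq_sum_inter [Fintype S] [MeasurableSingletonClass S] [IsFiniteMeasure μ]
    {f : Ω → S} (hf : Measurable f) (A : Set Ω) :
    μ.real A = ∑ w, μ.real (A ∩ {ω | f ω = w}) := by
  have h := sum_measureReal_preimage_singleton (μ := μ.restrict A) (f := f) Finset.univ
    (fun w _ => hf (measurableSet_singleton w))
  simp only [Finset.coe_univ, Set.preimage_univ, measureReal_restrict_apply MeasurableSet.univ,
    Set.univ_inter] at h
  rw [← h]
  refine Finset.sum_congr rfl fun w _ => ?_
  rw [measureReal_restrict_apply (hf (measurableSet_singleton w)), Set.inter_comm]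
  rfl

/-- The path formula is homogeneous in the measure, so conditioning on the initial state needs no
normalisation, and null initial states need no separate treatment. -/
theorem IsMarkovChain.restrict [Finite S] [MeasurableSingletonClass S]
    {Z : ℕ → Ω → S} {Q : Matrix S S ℝ} (h : IsMarkovChain Z Q μ) (w : S) :
    IsMarkovChain Z Q (μ.restrict {ω | Z 0 ω = w}) := by
  refine ⟨h.measurable, fun n z => ?_⟩
  have hw : MeasurableSet {ω | Z 0 ω = w} := h.measurable 0 (measurableSet_singleton w)
  rw [measureReal_restrict_apply' hw, measureReal_restrict_apply' hw]
  by_cases hz : z 0 = w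
  · rw [Set.inter_eq_left.mpr, Set.inter_eq_left.mpr, h.path_prob]
    · exact fun ω hω => hω.trans hz
    · exact fun ω hω => (hω 0 (Nat.zero_le _)).trans hz
  · have h1 : {ω | ∀ k ≤ n, Z k ω = z k} ∩ {ω | Z 0 ω = w} = ∅ := by
      ext ω
      simp only [Set.mem_inter_iff, Set.mem_ofPred_eq, Set.mem_empty_iff_false, iff_false, not_and]
      exact fun h1 h2 => hz ((h1 0 (Nat.zero_le _)).symm.trans h2)
    have h2 : {ω | Z 0 ω = z 0} ∩ {ω | Z 0 ω = w} = ∅ := by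
      ext ω
      simp only [Set.mem_inter_iff, Set.mem_ofPred_eq, Set.mem_empty_iff_false, iff_false, not_and]
      exact fun h1 h2 => hz (h1.symm.trans h2)
    rw [h1, h2]
    simp

theorem IsMarkovChain.measureReal_cons {Z : ℕ → Ω → S} {Q : Matrix S S ℝ}
    (h : IsMarkovChain Z Q μ) (n : ℕ) (w : S) (z : ℕ → S) :
    μ.real ({ω | ∀ k ≤ n, Z (k + 1) ω = z k} ∩ {ω | Z 0 ω = w}) =
      μ.real {ω | Z 0 ω = w} * Q w (z 0) * ∏ k ∈ Finset.range n, Q (z k) (z (k + 1)) := by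
  have h1 := h.path_prob (n + 1) (fun k => k.casesOn w z)
  rw [Finset.prod_range_succ'] at h1
  refine Eq.trans ?_ (h1.trans ?_)
  swap
  · rw [mul_assoc, mul_comm (Q w (z 0))]
    rfl
  congr 1
  ext ω
  simp only [Set.mem_inter_iff, Set.mem_ofPred_eq]
  constructor
  · rintro ⟨h2, h3⟩ (_ | k) hk
    · exact h3
    · exact h2 k (by omega)
  · exact fun h2 => ⟨fun k hk => h2 (k + 1) (by omega), h2 0 (by omega)⟩

theorem IsMarkovChain.measureReal_one_inter {Z : ℕ → Ω → S} {Q : Matrix S S ℝ}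
    (h : IsMarkovChain Z Q μ) (w u : S) :
    μ.real ({ω | Z 1 ω = u} ∩ {ω | Z 0 ω = w}) = μ.real {ω | Z 0 ω = w} * Q w u := by
  simpa using h.measureReal_cons 0 w (fun _ => u)

/-- Sum the path formula over the discarded initial state. With `IsMarkovChain.restrict` this
provides first-step analysis. -/
theorem IsMarkovChain.shift [Fintype S] [MeasurableSingletonClass S] [IsFiniteMeasure μ]
    {Z : ℕ → Ω → S} {Q : Matrix S S ℝ} (h : IsMarkovChain Z Q μ) :
    IsMarkovChain (fun n => Z (n + 1)) Q μ := by
  refine ⟨fun n => h.measurable _, fun n z => ?_⟩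
  rw [measureReal_eq_sum_inter (h.measurable 0) {ω | Z (0 + 1) ω = z 0},
    measureReal_eq_sum_inter (h.measurable 0), Finset.sum_mul]
  exact Finset.sum_congr rfl fun w _ => by
    rw [h.measureReal_cons, zero_add, h.measureReal_one_inter]

/-- Path probabilities of independently moving particles, with separate constraints on each
particle. -/
theorem IsMarkovChain.measureReal_constraints {ι : Type*} [Fintype ι] [DecidableEq ι] [Fintype S]
    [MeasurableSingletonClass S]
    {Q : Matrix S S ℝ} (n : ℕ) {μ : Measure Ω} [IsFiniteMeasure μ] {Z : ℕ → Ω → ι → S}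
    (h : IsMarkovChain Z (Matrix.of fun y z => ∏ l, Q (y l) (z l)) μ) (C : ι → ℕ → S → Prop) :
    μ.real {ω | ∀ l, ∀ k ≤ n, C l k (Z k ω l)} =
      ∑ w, μ.real {ω | Z 0 ω = w} * ∏ l, pathWeight Q n (C l) (w l) := by
  classical
  induction n generalizing μ Z C with
  | zero =>
    rw [measureReal_eq_sum_inter (h.measurable 0)]
    refine Finset.sum_congr rfl fun w _ => ?_
    by_cases hw : ∀ l, C l 0 (w l)
    · rw [Set.inter_eq_right.mpr, Finset.prod_eq_one, mul_one]
      · intro l _; simp [pathWeight, hw l]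
      · intro ω hω l k hk
        obtain rfl : k = 0 := by omega
        rw [show Z 0 ω = w from hω]
        exact hw l
    · obtain ⟨l, hl⟩ := not_forall.mp hw
      rw [Finset.prod_eq_zero (Finset.mem_univ l) (by simp [pathWeight, hl]), mul_zero]
      convert measureReal_empty (μ := μ)
      ext ω
      simp only [Set.mem_inter_iff, Set.mem_ofPred_eq, Set.mem_empty_iff_false, iff_false, not_and]
      rintro h1 rfl
      exact hl (h1 l 0 le_rfl)
  | succ n ih =>
    rw [measureReal_eq_sum_inter (h.measurable 0)]
    refine Finset.sum_congr rfl fun w _ => ?_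
    by_cases hw : ∀ l, C l 0 (w l)
    · have e1 : {ω | ∀ l, ∀ k ≤ n + 1, C l k (Z k ω l)} ∩ {ω | Z 0 ω = w} =
          {ω | ∀ l, ∀ k ≤ n, C l (k + 1) (Z (k + 1) ω l)} ∩ {ω | Z 0 ω = w} := by
        ext ω
        simp only [Set.mem_inter_iff, Set.mem_ofPred_eq, and_congr_left_iff]
        rintro rfl
        constructor
        · exact fun H l k hk => H l (k + 1) (by omega)
        · rintro H l (_ | k) hk
          · exact hw l
          · exact H l k (by omega)
      have hm : MeasurableSet {ω | Z 0 ω = w} := h.measurable 0 (measurableSet_singleton w)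
      -- First-step analysis: the induction hypothesis, available for every finite measure, is
      -- applied to the shifted chain on the event that it starts at w.
      rw [e1, ← measureReal_restrict_apply' hm,
        ih (h.restrict w).shift (fun l k => C l (k + 1))]
      have e2 : ∀ u, (μ.restrict {ω | Z 0 ω = w}).real {ω | Z (0 + 1) ω = u} =
          μ.real {ω | Z 0 ω = w} * ∏ l, Q (w l) (u l) := fun u => by
        rw [measureReal_restrict_apply' hm, zero_add, h.measureReal_one_inter]
        rfl
      simp_rw [e2, mul_assoc, ← Finset.prod_mul_distrib]
      rw [← Finset.mul_sum]
      congr 1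
      -- The sum over next configurations factorises into one sum per particle.
      have := Finset.prod_univ_sum (fun _ : ι => (Finset.univ : Finset S))
        (fun l u => Q (w l) u * pathWeight Q n (fun k => C l (k + 1)) u)
      rw [Fintype.piFinset_univ] at this
      rw [← this]
      refine Finset.prod_congr rfl fun l _ => ?_
      rw [pathWeight, if_pos (hw l)]
    · obtain ⟨l, hl⟩ := not_forall.mp hw
      rw [Finset.prod_eq_zero (Finset.mem_univ l) (by simp [pathWeight, hl]), mul_zero]
      convert measureReal_empty (μ := μ)
      ext ω
      simp only [Set.mem_inter_iff, Set.mem_ofPred_eq, Set.mem_empty_iff_false, iff_false, not_and]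
      rintro h1 rfl
      exact hl (h1 l 0 (Nat.zero_le _))

/-- Two-point marginals of independently moving particles, with different times for different
particles. -/
theorem IsMarkovChain.measureReal_two_times {ι : Type*} [Fintype ι] [DecidableEq ι] [Fintype S]
    [DecidableEq S] [MeasurableSingletonClass S] {Q : Matrix S S ℝ} (hQ : ∀ a, ∑ b, Q a b = 1)
    [IsFiniteMeasure μ] {Z : ℕ → Ω → ι → S}
    (h : IsMarkovChain Z (Matrix.of fun y z => ∏ l, Q (y l) (z l)) μ) (m d : ι → ℕ) (y z : ι → S) :
    μ.real {ω | ∀ l, Z (m l) ω l = y l ∧ Z (m l + d l) ω l = z l} =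
      ∑ w, μ.real {ω | Z 0 ω = w} * ∏ l, ((Q ^ m l) (w l) (y l) * (Q ^ d l) (y l) (z l)) := by
  -- The sum of all observation times serves as a common horizon for the particles.
  have hn : ∀ l, m l + d l ≤ ∑ l, (m l + d l) := fun l =>
    Finset.single_le_sum (f := fun l => m l + d l) (fun _ _ => Nat.zero_le _) (Finset.mem_univ l)
  have h1 := h.measureReal_constraints (∑ l, (m l + d l))
    (fun l k u => (k = m l → u = y l) ∧ (k = m l + d l → u = z l))
  simp_rw [fun (w : ι → S) l => pathWeight_eq_pow_mul_pow hQ (hn l) (w l) (y l) (z l)] at h1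
  refine Eq.trans ?_ h1
  congr 1
  ext ω
  simp only [Set.mem_ofPred_eq]
  constructor
  · rintro H l k _
    exact ⟨fun hk => hk ▸ (H l).1, fun hk => hk ▸ (H l).2⟩
  · exact fun H l => ⟨(H l (m l) (by have := hn l; omega)).1 rfl, (H l _ (hn l)).2 rfl⟩

end Chain

end Ehrenfest

/-! ### Averaging over the Poisson clocks. -/

namespace Ehrenfest

theorem integral_pow_poissonMeasure (ρ : ℝ≥0) (r : ℝ) :
    ∫ n, r ^ n ∂(poissonMeasure ρ) = Real.exp (-(ρ * (1 - r))) := by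
  rw [integral_poissonMeasure]
  have h := (NormedSpace.expSeries_div_hasSum_exp (𝔸 := ℝ) (ρ * r)).mul_left (Real.exp (-(ρ : ℝ)))
  rw [← congrFun Real.exp_eq_exp_ℝ, ← Real.exp_add] at h
  rw [show -((ρ : ℝ) * (1 - r)) = -ρ + ρ * r by ring, ← h.tsum_eq]
  congr 1
  ext n
  rw [smul_eq_mul, mul_pow]
  ring

variable {Ω : Type*} [MeasurableSpace Ω] {μ : Measure Ω}

/-- Fubini for the product law: V is frozen while the probability over U is computed. It serves to
treat the clock readings as deterministic times. -/
theorem measureReal_eq_integral_of_indepFun [IsProbabilityMeasure μ] {𝓤 𝓥 : Type*}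
    [MeasurableSpace 𝓤] [MeasurableSpace 𝓥] {U : Ω → 𝓤} {V : Ω → 𝓥} (h : IndepFun U V μ)
    (hU : Measurable U) (hV : Measurable V) {B : Set (𝓤 × 𝓥)} (hB : MeasurableSet B) :
    μ.real {ω | (U ω, V ω) ∈ B} = ∫ ω, μ.real {ω' | (U ω', V ω) ∈ B} ∂μ := by
  have hm : Measurable fun v => (μ.map U) ((fun u => (u, v)) ⁻¹' B) :=
    measurable_measure_prodMk_right hB
  have := Measure.isProbabilityMeasure_map (μ := μ) hU.aemeasurable
  have e : ∀ v, (μ.map U) ((fun u => (u, v)) ⁻¹' B) = μ {ω' | (U ω', v) ∈ B} := fun v =>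
    Measure.map_apply hU (measurable_prodMk_right hB)
  have h1 := (indepFun_iff_map_prod_eq_prod_map_map hU.aemeasurable hV.aemeasurable).mp h
  have h2 : μ {ω | (U ω, V ω) ∈ B} = ∫⁻ ω, μ {ω' | (U ω', V ω) ∈ B} ∂μ := by
    change μ ((fun ω => (U ω, V ω)) ⁻¹' B) = _
    rw [← Measure.map_apply (hU.prodMk hV) hB, h1, Measure.prod_apply_symm hB,
      lintegral_map hm hV]
    simp_rw [e]
  simp_rw [e] at hm
  rw [measureReal_def, h2]
  exact (integral_toReal (hm.comp hV).aemeasurable (ae_of_all _ fun _ => measure_lt_top _ _)).symm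

theorem integral_ballProb_pow [IsProbabilityMeasure μ] {D : Ω → ℕ} {ρ : ℝ≥0} {r : ℝ}
    (hr : |r| ≤ 1) (hD : HasLaw D (poissonMeasure ρ) μ) (p : ℝ) (a b : Fin 2) :
    ∫ ω, ballProb p (r ^ D ω) a b ∂μ = ballProb p (Real.exp (-(ρ * (1 - r)))) a b := by
  have hi : Integrable (fun ω => r ^ D ω) μ := by
    refine Integrable.of_bound
      ((Measurable.of_discrete (f := fun n : ℕ => r ^ n)).comp_aemeasurable
        hD.aemeasurable).aestronglyMeasurable 1 (ae_of_all _ fun ω => ?_)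
    rw [Real.norm_eq_abs, abs_pow]
    exact pow_le_one₀ (abs_nonneg _) hr
  unfold ballProb
  rw [integral_add (integrable_const _) (hi.mul_const _), integral_const, integral_mul_const,
    ← integral_pow_poissonMeasure, ← hD.map_eq, integral_map hD.aemeasurable
      (Measurable.of_discrete).aestronglyMeasurable]
  simp

theorem abs_ballProb_pow_le {r : ℝ} (hr : |r| ≤ 1) (p : ℝ) (n : ℕ) (a b : Fin 2) :
    |ballProb p (r ^ n) a b| ≤
      |![1 - p, p] b| + |(if a = b then 1 else 0) - ![1 - p, p] b| := by
  refine (abs_add_le _ _).trans (add_le_add_right ?_ _)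
  rw [abs_mul, abs_pow]
  exact mul_le_of_le_one_left (abs_nonneg _) (pow_le_one₀ (abs_nonneg _) hr)

/-- The correlation of a ball with its initial state at time `t`. -/
noncomputable def decay (lam : ℝ≥0) (α β : ℝ) (t : ℝ≥0) : ℝ :=
  Real.exp (-((lam : ℝ) * (α + β) * t))

section System

variable {N : ℕ} {lam : ℝ≥0} {α β : ℝ} {Yhat : Fin N → ℕ → Ω → Fin 2} {T : Fin N → ℝ≥0 → Ω → ℕ}

/-- Independence of T s and the following increment splits the expectation, and each factor is a
Poisson generating function at r. Since `decay` sees only the sum of its two real parameters, 0 and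
1 - r encode the rate λ(1 - r). -/
theorem IsPoissonProcess.integral_ballProb_mul [IsProbabilityMeasure μ] {T : ℝ≥0 → Ω → ℕ}
    (h : IsPoissonProcess T lam μ) {r : ℝ} (hr : |r| ≤ 1) (p : ℝ) (s t : ℝ≥0) (a b c : Fin 2) :
    ∫ ω, ballProb p (r ^ T s ω) a b * ballProb p (r ^ (T (t + s) ω - T s ω)) b c ∂μ =
      ballProb p (decay lam 0 (1 - r) s) a b * ballProb p (decay lam 0 (1 - r) t) b c := by
  have h0 : HasLaw (T s) (poissonMeasure (lam * s)) μ := by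
    refine (h.law 0 s).congr ?_
    filter_upwards [h.zero] with ω hω
    simp [hω]
  have h1 : HasLaw (fun ω => T (t + s) ω - T s ω) (poissonMeasure (lam * t)) μ := by
    rw [add_comm]; exact h.law s t
  have hind : IndepFun (T s) (fun ω => T (t + s) ω - T s ω) μ := by
    refine (h.indep.indepFun_sub_sub (zero_le : 0 ≤ s) (le_add_self : s ≤ t + s)).congr ?_
      (Filter.EventuallyEq.refl _ _)
    filter_upwards [h.zero] with ω hω
    simp [hω]
  rw [hind.integral_fun_comp_mul_comp (f := fun n => ballProb p (r ^ n) a b)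
    (g := fun n => ballProb p (r ^ n) b c) h0.aemeasurable h1.aemeasurable
    Measurable.of_discrete.aestronglyMeasurable Measurable.of_discrete.aestronglyMeasurable,
    integral_ballProb_pow hr h0, integral_ballProb_pow hr h1]
  simp only [decay, zero_add]
  push_cast
  congr 3 <;> ring_nf

theorem IsEhrenfestSystem.measurable_chains (h : IsEhrenfestSystem N lam α β Yhat T μ)
    (l : Fin N) (n : ℕ) : Measurable (Yhat l n) :=
  (measurable_pi_apply l).comp (h.chains.measurable n)

theorem IsEhrenfestSystem.measurable_ball (h : IsEhrenfestSystem N lam α β Yhat T μ)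
    (l : Fin N) (t : ℝ≥0) : Measurable (ball Yhat T l t) :=
  (measurable_from_prod_countable_right (f := fun x : ℕ × Ω => Yhat l x.1 x.2)
    fun n => h.measurable_chains l n).comp (((h.poisson l).measurable t).prodMk measurable_id)

/-- Two-time marginals of the configuration process. -/
theorem IsEhrenfestSystem.measureReal_ball [IsProbabilityMeasure μ]
    (h : IsEhrenfestSystem N lam α β Yhat T μ)
    (hα0 : 0 < α) (hα1 : α ≤ 1) (hβ0 : 0 < β) (hβ1 : β ≤ 1) (s t : ℝ≥0) (y z : Fin N → Fin 2) :
    μ.real {ω | ∀ l, ball Yhat T l s ω = y l ∧ ball Yhat T l (t + s) ω = z l} =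
      ∑ w, μ.real {ω | (fun l => Yhat l 0 ω) = w} *
        ∏ l, (ballProb (α / (α + β)) (decay lam α β s) (w l) (y l) *
          ballProb (α / (α + β)) (decay lam α β t) (y l) (z l)) := by
  have hr : |1 - (α + β)| ≤ 1 := abs_le.mpr ⟨by linarith, by linarith⟩
  have hab : α + β ≠ 0 := by positivity
  have hdec : ∀ u, decay lam 0 (1 - (1 - (α + β))) u = decay lam α β u := fun u => by
    simp [decay]
  -- Clock paths are monotone almost surely, so the truncated difference is a genuine increment.
  have e1 : μ.real {ω | ∀ l, ball Yhat T l s ω = y l ∧ ball Yhat T l (t + s) ω = z l} =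
      μ.real {ω | ∀ l, Yhat l (T l s ω) ω = y l ∧
        Yhat l (T l s ω + (T l (t + s) ω - T l s ω)) ω = z l} := by
    refine measureReal_congr ?_
    have hmono : ∀ᵐ ω ∂μ, ∀ l, Monotone fun t => T l t ω :=
      ae_all_iff.mpr fun l => (h.poisson l).paths.mono fun ω hω => hω.1
    filter_upwards [hmono] with ω hω
    have : ∀ l, T l s ω + (T l (t + s) ω - T l s ω) = T l (t + s) ω := fun l =>
      Nat.add_sub_of_le (hω l le_add_self)
    simp only [Set.ofPred, ball, this]
  have hU : Measurable fun ω l n => Yhat l n ω :=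
    measurable_pi_lambda _ fun l => measurable_pi_lambda _ fun n => h.measurable_chains l n
  have hT : Measurable fun ω l t => T l t ω :=
    measurable_pi_lambda _ fun l => measurable_pi_lambda _ fun t => (h.poisson l).measurable t
  let φ : (Fin N → ℝ≥0 → ℕ) → (Fin N → ℕ × ℕ) := fun f l => (f l s, f l (t + s) - f l s)
  have hφ : Measurable φ := by fun_prop
  have hind := h.chains_indep_poisson.comp measurable_id hφ
  let B : Set ((Fin N → ℕ → Fin 2) × (Fin N → ℕ × ℕ)) :=
    {x | ∀ l, x.1 l (x.2 l).1 = y l ∧ x.1 l ((x.2 l).1 + (x.2 l).2) = z l}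
  have hB : MeasurableSet B := by
    -- Evaluation at a variable time is measurable because the time takes countably many values.
    have hev : ∀ (l : Fin N) (f : ℕ × ℕ → ℕ), Measurable
        fun x : (Fin N → ℕ → Fin 2) × (Fin N → ℕ × ℕ) => x.1 l (f (x.2 l)) := fun l f =>
      (measurable_from_prod_countable_right (f := fun x : ℕ × (Fin N → ℕ → Fin 2) => x.2 l x.1)
        fun n => (measurable_pi_apply n).comp (measurable_pi_apply l)).comp
        (((Measurable.of_discrete (f := f)).comp (by fun_prop)).prodMk measurable_fst)
    simp only [B, Set.ofPred_forall, Set.ofPred_and]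
    exact MeasurableSet.iInter fun l =>
      (hev l Prod.fst (measurableSet_singleton (y l))).inter
        (hev l (fun x => x.1 + x.2) (measurableSet_singleton (z l)))
  have e2 := measureReal_eq_integral_of_indepFun hind hU (hφ.comp hT) hB
  have e3 : ∀ ω, μ.real {ω' | ((id ∘ fun ω l n => Yhat l n ω) ω', (φ ∘ fun ω l t => T l t ω) ω) ∈ B}
      = ∑ w, μ.real {ω | (fun l => Yhat l 0 ω) = w} *
        ∏ l, (ballProb (α / (α + β)) ((1 - (α + β)) ^ T l s ω) (w l) (y l) *
          ballProb (α / (α + β)) ((1 - (α + β)) ^ (T l (t + s) ω - T l s ω)) (y l) (z l)) := by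
    intro ω
    have := h.chains.measureReal_two_times (sum_ballMatrix α β) (fun l => T l s ω)
      (fun l => T l (t + s) ω - T l s ω) y z
    simp_rw [ballMatrix_pow hab] at this
    exact this
  have hTm : ∀ (l : Fin N) (u : ℝ≥0), Measurable (T l u) := fun l u => (h.poisson l).measurable u
  have hm : ∀ (a b c : Fin 2), Measurable fun x : ℝ≥0 → ℕ =>
      ballProb (α / (α + β)) ((1 - (α + β)) ^ x s) a b *
        ballProb (α / (α + β)) ((1 - (α + β)) ^ (x (t + s) - x s)) b c := fun a b c =>
    (Measurable.of_discrete (f := fun n : ℕ × ℕ =>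
      ballProb (α / (α + β)) ((1 - (α + β)) ^ n.1) a b *
        ballProb (α / (α + β)) ((1 - (α + β)) ^ (n.2 - n.1)) b c)).comp
      (show Measurable fun x : ℝ≥0 → ℕ => (x s, x (t + s)) by fun_prop)
  rw [e1]
  refine e2.trans ?_
  simp_rw [e3]
  rw [integral_finsetSum]
  · refine Finset.sum_congr rfl fun w _ => ?_
    rw [integral_const_mul]
    congr 1
    -- Independence of the clocks turns the expectation of the product over balls into a product of
    -- expectations.
    rw [h.poisson_indep.integral_fun_prod_comp
      (f := fun l x => ballProb (α / (α + β)) ((1 - (α + β)) ^ x s) (w l) (y l) *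
        ballProb (α / (α + β)) ((1 - (α + β)) ^ (x (t + s) - x s)) (y l) (z l))
      (fun l => (measurable_pi_lambda _ fun u => hTm l u).aemeasurable)
      (fun l => (hm _ _ _).aestronglyMeasurable)]
    refine Finset.prod_congr rfl fun l _ => ?_
    rw [(h.poisson l).integral_ballProb_mul hr, hdec, hdec]
  · intro w _
    refine Integrable.const_mul (Integrable.of_bound (C := ∏ l,
      ((|![1 - α / (α + β), α / (α + β)] (y l)| +
        |(if w l = y l then 1 else 0) - ![1 - α / (α + β), α / (α + β)] (y l)|) *
      (|![1 - α / (α + β), α / (α + β)] (z l)| +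
        |(if y l = z l then 1 else 0) - ![1 - α / (α + β), α / (α + β)] (z l)|)))
      ?_ (ae_of_all _ fun ω => ?_)) _
    · refine Measurable.aestronglyMeasurable (Finset.measurable_prod _ fun l _ => ?_)
      exact (hm (w l) (y l) (z l)).comp (measurable_pi_lambda _ fun u => hTm l u)
    · rw [Real.norm_eq_abs, Finset.abs_prod]
      refine Finset.prod_le_prod (fun _ _ => abs_nonneg _) fun l _ => ?_
      rw [abs_mul]
      exact mul_le_mul (abs_ballProb_pow_le hr _ _ _ _) (abs_ballProb_pow_le hr _ _ _ _)
        (abs_nonneg _) (by positivity)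

end System

end Ehrenfest

/-! ### The law of the ball count: transitions, moments, limits and invariance. -/

namespace Ehrenfest

variable {Ω : Type*} [MeasurableSpace Ω] {μ : Measure Ω}

open Classical in
theorem measureReal_setOf_eq_sum {S : Type*} [Fintype S] [MeasurableSpace S]
    [MeasurableSingletonClass S] [IsFiniteMeasure μ] {f : Ω → S} (hf : Measurable f)
    (P : S → Prop) :
    μ.real {ω | P (f ω)} = ∑ w, if P w then μ.real {ω | f ω = w} else 0 := by
  rw [measureReal_eq_sum_inter hf]
  refine Finset.sum_congr rfl fun w _ => ?_
  split_ifs with h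
  · rw [Set.inter_eq_right.mpr]
    rintro ω rfl
    exact h
  · convert measureReal_empty (μ := μ)
    ext ω
    simp only [Set.mem_inter_iff, Set.mem_ofPred_eq, Set.mem_empty_iff_false, iff_false, not_and]
    rintro h1 rfl
    exact h h1

section Bounded

variable {N : ℕ} {Y : Ω → ℕ}

theorem integral_comp_eq_sum_of_le [IsFiniteMeasure μ] (hY : Measurable Y) (hN : ∀ ω, Y ω ≤ N)
    (f : ℕ → ℝ) :
    ∫ ω, f (Y ω) ∂μ = ∑ j ∈ Finset.range (N + 1), μ.real {ω | Y ω = j} * f j := by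
  have h : ∀ ω, f (Y ω) =
      ∑ j ∈ Finset.range (N + 1), Set.indicator {ω | Y ω = j} (fun _ => f j) ω := by
    intro ω
    simp only [Set.indicator_apply, Set.mem_ofPred_eq]
    rw [Finset.sum_ite_eq, if_pos (Finset.mem_range.mpr (Nat.lt_succ_of_le (hN ω)))]
  have hm : ∀ j, MeasurableSet {ω | Y ω = j} := fun j => hY (measurableSet_singleton j)
  simp_rw [h]
  rw [integral_finsetSum _ fun j _ => (integrable_const _).indicator (hm j)]
  exact Finset.sum_congr rfl fun j _ => by rw [integral_indicator_const _ (hm j), smul_eq_mul]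

theorem measureReal_eq_sum_inter_of_le [IsFiniteMeasure μ] (hY : Measurable Y) (hN : ∀ ω, Y ω ≤ N)
    (A : Set Ω) :
    μ.real A = ∑ i ∈ Finset.range (N + 1), μ.real ({ω | Y ω = i} ∩ A) := by
  have h := integral_comp_eq_sum_of_le (μ := μ.restrict A) hY hN fun _ => 1
  simp only [integral_const, measureReal_restrict_apply MeasurableSet.univ, Set.univ_inter,
    smul_eq_mul, mul_one] at h
  rw [h]
  exact Finset.sum_congr rfl fun i _ =>
    measureReal_restrict_apply (hY (measurableSet_singleton i))

end Bounded

section Polynomial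

open Polynomial

theorem eval_one_derivative_eq_sum {P : ℝ[X]} {N : ℕ} (hP : P.natDegree ≤ N) :
    (derivative P).eval 1 = ∑ j ∈ Finset.range (N + 1), P.coeff j * j := by
  conv_lhs => rw [P.as_sum_range' (N + 1) (Nat.lt_succ_of_le hP)]
  simp [derivative_monomial, eval_finsetSum]

theorem eval_one_derivative_derivative_eq_sum {P : ℝ[X]} {N : ℕ} (hP : P.natDegree ≤ N) :
    (derivative (derivative P)).eval 1 =
      ∑ j ∈ Finset.range (N + 1), P.coeff j * (j * (j - 1)) := by
  conv_lhs => rw [P.as_sum_range' (N + 1) (Nat.lt_succ_of_le hP)]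
  simp only [derivative_sum, derivative_monomial, eval_finsetSum, eval_monomial, one_pow, mul_one]
  refine Finset.sum_congr rfl fun j _ => ?_
  cases j <;> simp [mul_assoc]

end Polynomial

theorem tendsto_coeff_genPoly {N i j : ℕ} {p : ℝ} (hp0 : 0 < p) (hp1 : p < 1) (hi : i ≤ N)
    (hj : j ≤ N) {ι : Type*} {F : Filter ι} {e : ι → ℝ} (he : Tendsto e F (𝓝 0)) :
    Tendsto (fun t => (genPoly N p (e t) i).coeff j) F
      (𝓝 ((N.choose j : ℝ) * p ^ j * (1 - p) ^ (N - j))) := by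
  rw [← coeff_genPoly_zero (p := p) hi]
  have : Continuous fun x : ℝ => (genPoly N p x i).coeff j := by
    simp_rw [coeff_genPoly hp0 hp1 _ hi hj]
    fun_prop
  exact (this.tendsto 0).comp he

theorem tendsto_decay {lam : ℝ≥0} {α β : ℝ} (hlam : 0 < lam) (h : 0 < α + β) :
    Tendsto (decay lam α β) atTop (𝓝 0) := by
  have hc : 0 < (lam : ℝ) * (α + β) := mul_pos (by exact_mod_cast hlam) h
  exact Real.tendsto_exp_neg_atTop_nhds_zero.comp
    (NNReal.tendsto_coe_atTop.mpr tendsto_id |>.const_mul_atTop hc)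

theorem sum_binomial_mul_coeff_genPoly (N j : ℕ) (p e : ℝ) :
    ∑ i ∈ Finset.range (N + 1), (N.choose i : ℝ) * p ^ i * (1 - p) ^ (N - i) *
      (genPoly N p e i).coeff j = (N.choose j : ℝ) * p ^ j * (1 - p) ^ (N - j) := by
  have h := congrArg (fun P => P.coeff j) (sum_binomial_mul_genPoly N p e)
  simpa only [Polynomial.finsetSum_coeff, Polynomial.coeff_C_mul,
    coeff_genPoly_zero (Nat.zero_le N)] using h

/-- Point masses up to N suffice, since beyond N both measures vanish. -/
theorem eq_binomial_iff {N : ℕ} {p : unitInterval} {π : Measure ℕ} [IsProbabilityMeasure π]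
    (hπ : π (Set.Iic N) = 1) :
    π = binomial N p ↔
      ∀ j ≤ N, π.real {j} = (N.choose j : ℝ) * (p : ℝ) ^ j * (1 - p) ^ (N - j) := by
  constructor
  · rintro rfl j _
    exact binomial_real_singleton N j p
  · intro h
    refine Measure.ext_of_measureReal_singleton fun j => ?_
    rw [binomial_real_singleton]
    by_cases hj : j ≤ N
    · exact h j hj
    · rw [Nat.choose_eq_zero_of_lt (not_le.mp hj)]
      have h1 : π (Set.Iic N)ᶜ = 0 := (prob_compl_eq_zero_iff measurableSet_Iic).mpr hπ
      have h2 : π {j} = 0 := measure_mono_null (by simpa using hj) h1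
      simp [measureReal_def, h2]

/-- The binomial distribution is the only invariant distribution of the transition kernel. -/
theorem invariant_iff_eq_binomial {N : ℕ} {lam : ℝ≥0} {α β : ℝ} (hlam : 0 < lam) (h : 0 < α + β)
    {p : unitInterval} (hp0 : 0 < (p : ℝ)) (hp1 : (p : ℝ) < 1) {π : Measure ℕ}
    [IsProbabilityMeasure π] (hπ : π (Set.Iic N) = 1) :
    (∀ t : ℝ≥0, ∀ j ≤ N, ∑ i ∈ Finset.range (N + 1),
      π.real {i} * (genPoly N p (decay lam α β t) i).coeff j = π.real {j}) ↔
    π = binomial N p := by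
  rw [eq_binomial_iff hπ]
  constructor
  · intro H j hj
    -- Uniqueness: as t → ∞ every row tends to the binomial weights, while invariance keeps the left
    -- side constant.
    have h1 : Tendsto (fun t => ∑ i ∈ Finset.range (N + 1),
        π.real {i} * (genPoly N p (decay lam α β t) i).coeff j) atTop
        (𝓝 (∑ i ∈ Finset.range (N + 1),
          π.real {i} * ((N.choose j : ℝ) * (p : ℝ) ^ j * (1 - p) ^ (N - j)))) :=
      tendsto_finsetSum _ fun i hi => (tendsto_coeff_genPoly hp0 hp1
        (Nat.lt_succ_iff.mp (Finset.mem_range.mp hi)) hj (tendsto_decay hlam h)).const_mul _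
    simp_rw [fun t => H t j hj] at h1
    have h2 : ∑ i ∈ Finset.range (N + 1), π.real {i} = 1 := by
      rw [sum_measureReal_singleton, measureReal_def,
        show ((Finset.range (N + 1) : Finset ℕ) : Set ℕ) = Set.Iic N by ext; simp, hπ]
      simp
    rw [← Finset.sum_mul, h2, one_mul] at h1
    exact tendsto_nhds_unique tendsto_const_nhds h1
  · intro H t j hj
    rw [H j hj, ← sum_binomial_mul_coeff_genPoly N j p (decay lam α β t)]
    exact Finset.sum_congr rfl fun i hi => by
      rw [H i (Nat.lt_succ_iff.mp (Finset.mem_range.mp hi))]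

theorem process_le {Ω : Type*} {N : ℕ} {Yhat : Fin N → ℕ → Ω → Fin 2} {T : Fin N → ℝ≥0 → Ω → ℕ}
    (t : ℝ≥0) (ω : Ω) : process Yhat T t ω ≤ N := count_le _

section System

variable {N : ℕ} {lam : ℝ≥0} {α β : ℝ} {Yhat : Fin N → ℕ → Ω → Fin 2} {T : Fin N → ℝ≥0 → Ω → ℕ}

theorem IsEhrenfestSystem.measurable_config (h : IsEhrenfestSystem N lam α β Yhat T μ) (t : ℝ≥0) :
    Measurable fun ω l => ball Yhat T l t ω :=
  measurable_pi_lambda _ fun l => h.measurable_ball l t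

theorem IsEhrenfestSystem.measurable_process (h : IsEhrenfestSystem N lam α β Yhat T μ)
    (t : ℝ≥0) : Measurable (process Yhat T t) :=
  (Measurable.of_discrete (f := count)).comp (h.measurable_config t)

theorem decay_zero (lam : ℝ≥0) (α β : ℝ) : decay lam α β 0 = 1 := by simp [decay]

theorem ballProb_one (p : ℝ) (a : Fin 2) : ballProb p 1 a a = 1 := by simp [ballProb]

theorem IsEhrenfestSystem.measureReal_config [IsProbabilityMeasure μ]
    (h : IsEhrenfestSystem N lam α β Yhat T μ)
    (hα0 : 0 < α) (hα1 : α ≤ 1) (hβ0 : 0 < β) (hβ1 : β ≤ 1) (s : ℝ≥0) (y : Fin N → Fin 2) :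
    μ.real {ω | (fun l => ball Yhat T l s ω) = y} =
      ∑ w, μ.real {ω | (fun l => Yhat l 0 ω) = w} *
        ∏ l, ballProb (α / (α + β)) (decay lam α β s) (w l) (y l) := by
  -- A zero second time lag with y = z collapses the two-time law to the one-time law.
  have := h.measureReal_ball hα0 hα1 hβ0 hβ1 s 0 y y
  simp only [zero_add, and_self, decay_zero, ballProb_one, mul_one] at this
  simpa only [funext_iff] using this

/-- The factor for the second time lag does not involve the initial configuration w, so it leaves
the sum over w. -/
theorem IsEhrenfestSystem.measureReal_config_inter [IsProbabilityMeasure μ]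
    (h : IsEhrenfestSystem N lam α β Yhat T μ)
    (hα0 : 0 < α) (hα1 : α ≤ 1) (hβ0 : 0 < β) (hβ1 : β ≤ 1) (s t : ℝ≥0) (y z : Fin N → Fin 2) :
    μ.real {ω | ((fun l => ball Yhat T l s ω), (fun l => ball Yhat T l (t + s) ω)) = (y, z)} =
      μ.real {ω | (fun l => ball Yhat T l s ω) = y} *
        ∏ l, ballProb (α / (α + β)) (decay lam α β t) (y l) (z l) := by
  rw [h.measureReal_config hα0 hα1 hβ0 hβ1, Finset.sum_mul]
  have := h.measureReal_ball hα0 hα1 hβ0 hβ1 s t y z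
  simp_rw [Finset.prod_mul_distrib, ← mul_assoc, forall_and] at this
  simpa only [Prod.mk.injEq, funext_iff] using this

/-- The Markov property of the Ehrenfest process. -/
theorem IsEhrenfestSystem.measureReal_process_inter [IsProbabilityMeasure μ]
    (h : IsEhrenfestSystem N lam α β Yhat T μ)
    (hα0 : 0 < α) (hα1 : α ≤ 1) (hβ0 : 0 < β) (hβ1 : β ≤ 1) (s t : ℝ≥0) (i j : ℕ) :
    μ.real ({ω | process Yhat T s ω = i} ∩ {ω | process Yhat T (t + s) ω = j}) =
      μ.real {ω | process Yhat T s ω = i} *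
        (genPoly N (α / (α + β)) (decay lam α β t) i).coeff j := by
  classical
  have e1 := measureReal_setOf_eq_sum (μ := μ)
    ((h.measurable_config s).prodMk (h.measurable_config (t + s)))
    (fun x => count x.1 = i ∧ count x.2 = j)
  have e2 := measureReal_setOf_eq_sum (μ := μ) (h.measurable_config s) (fun x => count x = i)
  refine e1.trans (Eq.trans ?_ (congrArg (· * _) e2.symm))
  rw [Fintype.sum_prod_type, Finset.sum_mul]
  refine Finset.sum_congr rfl fun y _ => ?_
  by_cases hy : count y = i
  · subst hy
    simp only [if_true, true_and]
    -- Lumpability: the sum over z with a given count depends on y only through its count.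
    rw [← sum_prod_ballProb, Finset.mul_sum]
    refine Finset.sum_congr rfl fun z _ => ?_
    split_ifs
    · exact h.measureReal_config_inter hα0 hα1 hβ0 hβ1 s t y z
    · simp
  · simp [hy]

/-- For s > 0 the correlation is strictly below 1, so every one-ball transition is positive and
every configuration is reachable from any initial one. A null state would force all initial masses
to vanish. -/
theorem IsEhrenfestSystem.measure_process_pos [IsProbabilityMeasure μ]
    (h : IsEhrenfestSystem N lam α β Yhat T μ) (hlam : 0 < lam)
    (hα0 : 0 < α) (hα1 : α ≤ 1) (hβ0 : 0 < β) (hβ1 : β ≤ 1) {s : ℝ≥0} (hs : 0 < s) {i : ℕ}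
    (hi : i ≤ N) : μ {ω | process Yhat T s ω = i} ≠ 0 := by
  obtain ⟨y, hy⟩ := exists_count_eq hi
  have hsub : {ω | (fun l => ball Yhat T l s ω) = y} ⊆ {ω | process Yhat T s ω = i} := by
    intro ω hω
    have hω' : (fun l => ball Yhat T l s ω) = y := hω
    change count (fun l => ball Yhat T l s ω) = i
    rw [hω', hy]
  refine fun h0 => ?_
  have h1 : μ.real {ω | (fun l => ball Yhat T l s ω) = y} = 0 := by
    rw [measureReal_def, measure_mono_null hsub h0, ENNReal.toReal_zero]
  have hab : 0 < α + β := add_pos hα0 hβ0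
  have hpos : ∀ w : Fin N → Fin 2,
      0 < ∏ l, ballProb (α / (α + β)) (decay lam α β s) (w l) (y l) := fun w =>
    Finset.prod_pos fun l _ => ballProb_pos (div_pos hα0 hab)
      ((div_lt_one hab).mpr (by linarith)) (Real.exp_pos _).le
      (Real.exp_lt_one_iff.mpr (neg_lt_zero.mpr
        (mul_pos (mul_pos (by exact_mod_cast hlam) hab) (by exact_mod_cast hs)))) _ _
  rw [h.measureReal_config hα0 hα1 hβ0 hβ1,
    Finset.sum_eq_zero_iff_of_nonneg fun w _ => mul_nonneg measureReal_nonneg (hpos w).le] at h1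
  have h2 := measureReal_eq_sum_inter (μ := μ) (h.chains.measurable 0) Set.univ
  rw [Finset.sum_eq_zero] at h2
  · simp at h2
  · intro w hw
    rw [Set.univ_inter]
    exact (mul_eq_zero.mp (h1 w hw)).resolve_right (hpos w).ne'

theorem IsEhrenfestSystem.transProb_eq [IsProbabilityMeasure μ]
    (h : IsEhrenfestSystem N lam α β Yhat T μ)
    (hα0 : 0 < α) (hα1 : α ≤ 1) (hβ0 : 0 < β) (hβ1 : β ≤ 1) (s t : ℝ≥0) {i : ℕ} (j : ℕ)
    (hi : μ {ω | process Yhat T s ω = i} ≠ 0) :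
    transProb (process Yhat T) μ s t i j =
      (genPoly N (α / (α + β)) (decay lam α β t) i).coeff j := by
  have hm : MeasurableSet {ω | process Yhat T s ω = i} :=
    h.measurable_process s (measurableSet_singleton i)
  have h0 : μ.real {ω | process Yhat T s ω = i} ≠ 0 :=
    (measureReal_ne_zero_iff (measure_ne_top _ _)).mpr hi
  rw [transProb, measureReal_def, cond_apply hm, ENNReal.toReal_mul, ENNReal.toReal_inv,
    ← measureReal_def, ← measureReal_def, h.measureReal_process_inter hα0 hα1 hβ0 hβ1, ← mul_assoc,
    inv_mul_cancel₀ h0, one_mul]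

theorem IsEhrenfestSystem.measureReal_process_eq_sum [IsProbabilityMeasure μ]
    (h : IsEhrenfestSystem N lam α β Yhat T μ)
    (hα0 : 0 < α) (hα1 : α ≤ 1) (hβ0 : 0 < β) (hβ1 : β ≤ 1) (t : ℝ≥0) (j : ℕ) :
    μ.real {ω | process Yhat T t ω = j} = ∑ i ∈ Finset.range (N + 1),
      μ.real {ω | process Yhat T 0 ω = i} *
        (genPoly N (α / (α + β)) (decay lam α β t) i).coeff j := by
  rw [measureReal_eq_sum_inter_of_le (h.measurable_process 0) (process_le 0)]
  refine Finset.sum_congr rfl fun i _ => ?_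
  rw [← h.measureReal_process_inter hα0 hα1 hβ0 hβ1, add_zero]

/-- Expectations of the Ehrenfest process conditioned on its initial state. -/
theorem IsEhrenfestSystem.integral_cond_process [IsProbabilityMeasure μ]
    (h : IsEhrenfestSystem N lam α β Yhat T μ)
    (hα0 : 0 < α) (hα1 : α ≤ 1) (hβ0 : 0 < β) (hβ1 : β ≤ 1) (t : ℝ≥0) {i : ℕ}
    (hi : μ {ω | process Yhat T 0 ω = i} ≠ 0) (f : ℕ → ℝ) :
    ∫ ω, f (process Yhat T t ω) ∂(cond μ {ω | process Yhat T 0 ω = i}) =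
      ∑ j ∈ Finset.range (N + 1),
        (genPoly N (α / (α + β)) (decay lam α β t) i).coeff j * f j := by
  rw [integral_comp_eq_sum_of_le (h.measurable_process t) (process_le t)]
  refine Finset.sum_congr rfl fun j _ => ?_
  rw [← h.transProb_eq hα0 hα1 hβ0 hβ1 0 t j hi, transProb, add_zero]

theorem IsEhrenfestSystem.integral_cond_process_id [IsProbabilityMeasure μ]
    (h : IsEhrenfestSystem N lam α β Yhat T μ)
    (hα0 : 0 < α) (hα1 : α ≤ 1) (hβ0 : 0 < β) (hβ1 : β ≤ 1) (t : ℝ≥0) {i : ℕ} (hiN : i ≤ N)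
    (hi : μ {ω | process Yhat T 0 ω = i} ≠ 0) :
    ∫ ω, (process Yhat T t ω : ℝ) ∂(cond μ {ω | process Yhat T 0 ω = i}) =
      N * (α / (α + β)) - (N * (α / (α + β)) - i) * decay lam α β t := by
  rw [h.integral_cond_process hα0 hα1 hβ0 hβ1 t hi fun n => (n : ℝ),
    ← eval_one_derivative_eq_sum (natDegree_genPoly_le _ _ hiN),
    eval_one_derivative_genPoly _ _ hiN]
  ring

theorem IsEhrenfestSystem.variance_cond_process [IsProbabilityMeasure μ]
    (h : IsEhrenfestSystem N lam α β Yhat T μ)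
    (hα0 : 0 < α) (hα1 : α ≤ 1) (hβ0 : 0 < β) (hβ1 : β ≤ 1) (t : ℝ≥0) {i : ℕ} (hiN : i ≤ N)
    (hi : μ {ω | process Yhat T 0 ω = i} ≠ 0) {p : ℝ} (hp : p = α / (α + β)) :
    variance (fun ω => (process Yhat T t ω : ℝ)) (cond μ {ω | process Yhat T 0 ω = i}) =
      N * p * (1 - p) + (N * p - i) * (2 * p - 1) * decay lam α β t -
        (N * p * (1 - p) + (N * p - i) * (2 * p - 1)) * decay lam α β t ^ 2 := by
  have := cond_isProbabilityMeasure hi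
  have hL : MemLp (fun ω => (process Yhat T t ω : ℝ)) 2
      (cond μ {ω | process Yhat T 0 ω = i}) := by
    refine MemLp.of_bound ((Measurable.of_discrete (f := fun n : ℕ => (n : ℝ))).comp
      (h.measurable_process t)).aestronglyMeasurable N (ae_of_all _ fun ω => ?_)
    rw [Real.norm_natCast]
    exact_mod_cast process_le t ω
  have hsq := h.integral_cond_process hα0 hα1 hβ0 hβ1 t hi fun n => (n : ℝ) ^ 2
  have h1 := eval_one_derivative_eq_sum (natDegree_genPoly_le p (decay lam α β t) hiN)
  have h2 := eval_one_derivative_derivative_eq_sum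
    (natDegree_genPoly_le p (decay lam α β t) hiN)
  rw [eval_one_derivative_genPoly _ _ hiN] at h1
  rw [eval_one_derivative_derivative_genPoly _ _ hiN] at h2
  -- The second moment is the sum of the first two factorial moments, i.e. of derivatives of the
  -- generating function at 1.
  have h3 : ∑ j ∈ Finset.range (N + 1), (genPoly N p (decay lam α β t) i).coeff j * (j : ℝ) ^ 2 =
      ∑ j ∈ Finset.range (N + 1), (genPoly N p (decay lam α β t) i).coeff j * (j * (j - 1)) +
      ∑ j ∈ Finset.range (N + 1), (genPoly N p (decay lam α β t) i).coeff j * j := by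
    rw [← Finset.sum_add_distrib]
    exact Finset.sum_congr rfl fun j _ => by ring
  rw [variance_eq_sub hL]
  simp only [Pi.pow_apply]
  rw [hsq, h.integral_cond_process_id hα0 hα1 hβ0 hβ1 t hiN hi, ← hp, h3, ← h1, ← h2]
  ring

end System

end Ehrenfest

/-! ### Assembly of the theorem. -/

theorem mainTheorem3 {Ω : Type*} [MeasurableSpace Ω] (μ : Measure Ω) [IsProbabilityMeasure μ]
    (N : ℕ) (lam : ℝ≥0) (hlam : 0 < lam) (α β : ℝ)
    (hα0 : 0 < α) (hα1 : α ≤ 1) (hβ0 : 0 < β) (hβ1 : β ≤ 1)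
    (Yhat : Fin N → ℕ → Ω → Fin 2) (T : Fin N → ℝ≥0 → Ω → ℕ)
    (hsys : Ehrenfest.IsEhrenfestSystem N lam α β Yhat T μ)
    (X : ℝ≥0 → Ω → ℕ) (hX : X = Ehrenfest.process Yhat T)
    (p : unitInterval) (hp : (p : ℝ) = α / (α + β)) (q : ℝ) (hq : q = 1 - p) :
    -- (a) transition probabilities (every state is charged at every positive time)
    ((∀ s : ℝ≥0, 0 < s → ∀ i ≤ N, μ {ω | X s ω = i} ≠ 0) ∧
      ∀ s t : ℝ≥0, ∀ i ≤ N, ∀ j ≤ N, μ {ω | X s ω = i} ≠ 0 →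
        Ehrenfest.transProb X μ s t i j =
          (N.choose j : ℝ) * ((p : ℝ) / q) ^ j *
            ∑ x ∈ Finset.range (N + 1), (N.choose x : ℝ) * (p : ℝ) ^ x * q ^ (N - x) *
              Ehrenfest.krawtchouk N p i x * Ehrenfest.krawtchouk N p j x *
              Real.exp (-((lam : ℝ) * (α + β) * x * t))) ∧
    -- (b) conditional mean and variance
    (∀ t : ℝ≥0, ∀ i ≤ N, μ {ω | X 0 ω = i} ≠ 0 →
      (∫ ω, (X t ω : ℝ) ∂(cond μ {ω | X 0 ω = i}) =
        N * p - (N * p - i) * Real.exp (-((lam : ℝ) * (α + β) * t))) ∧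
      variance (fun ω => (X t ω : ℝ)) (cond μ {ω | X 0 ω = i}) =
        N * p * (1 - p) + (N * p - i) * (2 * p - 1) * Real.exp (-((lam : ℝ) * (α + β) * t)) -
          (N * p * (1 - p) + (N * p - i) * (2 * p - 1)) *
            Real.exp (-(2 * (lam : ℝ) * (α + β) * t))) ∧
    -- (c) stationary distribution: the only invariant distribution of the transition
    -- probabilities is binomial; the process is stationary exactly when started from it
    (∀ s : ℝ≥0, 0 < s → ∀ π : Measure ℕ, IsProbabilityMeasure π → π (Set.Iic N) = 1 →
      ((∀ t : ℝ≥0, ∀ j ≤ N, ∑ i ∈ Finset.range (N + 1),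
          π.real {i} * Ehrenfest.transProb X μ s t i j = π.real {j}) ↔
        π = binomial N p)) ∧
    ((∀ t : ℝ≥0, μ.map (X t) = μ.map (X 0)) ↔ μ.map (X 0) = binomial N p) ∧
    -- (c) limiting distribution
    (∀ s : ℝ≥0, ∀ i ≤ N, μ {ω | X s ω = i} ≠ 0 → ∀ j ≤ N,
      Tendsto (fun t : ℝ≥0 => Ehrenfest.transProb X μ s t i j) atTop
        (𝓝 ((binomial N p).real {j}))) ∧
    (∀ j ≤ N, Tendsto (fun t : ℝ≥0 => μ.real {ω | X t ω = j}) atTop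
      (𝓝 ((binomial N p).real {j}))) := by
  subst hX
  have hab : 0 < α + β := add_pos hα0 hβ0
  have hp0 : 0 < (p : ℝ) := hp ▸ div_pos hα0 hab
  have hp1 : (p : ℝ) < 1 := hp ▸ (div_lt_one hab).mpr (by linarith)
  have hK : ∀ (s t : ℝ≥0) (i j : ℕ), μ {ω | Ehrenfest.process Yhat T s ω = i} ≠ 0 →
      Ehrenfest.transProb (Ehrenfest.process Yhat T) μ s t i j =
        (Ehrenfest.genPoly N p (Ehrenfest.decay lam α β t) i).coeff j := fun s t i j hi => by
    rw [hp]
    exact hsys.transProb_eq hα0 hα1 hβ0 hβ1 s t j hi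
  have hpos : ∀ s : ℝ≥0, 0 < s → ∀ i ≤ N, μ {ω | Ehrenfest.process Yhat T s ω = i} ≠ 0 :=
    fun s hs i hi => hsys.measure_process_pos hlam hα0 hα1 hβ0 hβ1 hs hi
  have hsum := hsys.measureReal_process_eq_sum hα0 hα1 hβ0 hβ1
  rw [← hp] at hsum
  have hlim : ∀ i ≤ N, ∀ j ≤ N,
      Tendsto (fun t => (Ehrenfest.genPoly N p (Ehrenfest.decay lam α β t) i).coeff j) atTop
        (𝓝 ((binomial N p).real {j})) := fun i hi j hj => by
    rw [binomial_real_singleton]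
    exact Ehrenfest.tendsto_coeff_genPoly hp0 hp1 hi hj (Ehrenfest.tendsto_decay hlam hab)
  have hmap : ∀ (t : ℝ≥0) (j : ℕ), (μ.map (Ehrenfest.process Yhat T t)).real {j} =
      μ.real {ω | Ehrenfest.process Yhat T t ω = j} := fun t j =>
    map_measureReal_apply (hsys.measurable_process t) (measurableSet_singleton j)
  have hprob : ∀ t : ℝ≥0, IsProbabilityMeasure (μ.map (Ehrenfest.process Yhat T t)) := fun t =>
    Measure.isProbabilityMeasure_map (hsys.measurable_process t).aemeasurable
  have hsupp : ∀ t : ℝ≥0, (μ.map (Ehrenfest.process Yhat T t)) (Set.Iic N) = 1 := fun t => by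
    rw [Measure.map_apply (hsys.measurable_process t) measurableSet_Iic,
      Set.preimage_eq_univ_iff.mpr, measure_univ]
    rintro _ ⟨ω, rfl⟩
    exact Ehrenfest.process_le t ω
  have htotal : ∑ i ∈ Finset.range (N + 1), μ.real {ω | Ehrenfest.process Yhat T 0 ω = i} = 1 := by
    have := Ehrenfest.measureReal_eq_sum_inter_of_le (μ := μ) (hsys.measurable_process 0)
      (Ehrenfest.process_le 0) Set.univ
    simpa using this.symm
  refine ⟨⟨hpos, ?_⟩, ?_, ?_, ?_, ?_, ?_⟩
  · intro s t i hi j hj h0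
    rw [hK s t i j h0, Ehrenfest.coeff_genPoly hp0 hp1 _ hi hj, hq]
    congr 1
    refine Finset.sum_congr rfl fun x _ => ?_
    rw [Ehrenfest.decay, ← Real.exp_nat_mul]
    congr 2
    ring
  · intro t i hi h0
    constructor
    · rw [hsys.integral_cond_process_id hα0 hα1 hβ0 hβ1 t hi h0, ← hp, Ehrenfest.decay]
    · rw [hsys.variance_cond_process hα0 hα1 hβ0 hβ1 t hi h0 hp, Ehrenfest.decay,
        ← Real.exp_nat_mul]
      congr 3
      push_cast
      ring
  · intro s hs π hπ hπN
    rw [← Ehrenfest.invariant_iff_eq_binomial hlam hab hp0 hp1 hπN]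
    refine forall_congr' fun t => forall_congr' fun j => forall_congr' fun hj => ?_
    -- Since s > 0, every state is charged, so each conditional probability is the true transition
    -- probability.
    rw [Finset.sum_congr rfl fun i hi => by
      rw [hK s t i j (hpos s hs i (Nat.lt_succ_iff.mp (Finset.mem_range.mp hi)))]]
  · have := hprob 0
    rw [← Ehrenfest.invariant_iff_eq_binomial hlam hab hp0 hp1 (hsupp 0)]
    -- For the initial law, the invariance equations say exactly that the point masses at times t
    -- and 0 agree.
    simp_rw [hmap, ← hsum]
    constructor
    · intro H t j _
      rw [← hmap, ← hmap, H t]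
    · intro H t
      have := hprob t
      have hb : μ.map (Ehrenfest.process Yhat T 0) = binomial N p :=
        (Ehrenfest.invariant_iff_eq_binomial hlam hab hp0 hp1 (hsupp 0)).mp (by
          simpa only [hmap, ← hsum] using H)
      rw [hb, Ehrenfest.eq_binomial_iff (hsupp t)]
      intro j hj
      rw [hmap, H t j hj, ← hmap, hb, binomial_real_singleton]
  · intro s i hi h0 j hj
    simp_rw [fun t => hK s t i j h0]
    exact hlim i hi j hj
  · intro j hj
    simp_rw [fun t => hsum t j]
    have : Tendsto (fun t => ∑ i ∈ Finset.range (N + 1),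
        μ.real {ω | Ehrenfest.process Yhat T 0 ω = i} *
          (Ehrenfest.genPoly N p (Ehrenfest.decay lam α β t) i).coeff j) atTop
        (𝓝 (∑ i ∈ Finset.range (N + 1), μ.real {ω | Ehrenfest.process Yhat T 0 ω = i} *
          (binomial N p).real {j})) :=
      tendsto_finsetSum _ fun i hi =>
        (hlim i (Nat.lt_succ_iff.mp (Finset.mem_range.mp hi)) j hj).const_mul _
    rwa [← Finset.sum_mul, htotal, one_mul] at this
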